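/- Let $D\subset\mathbb R^3$ be a bounded domain that is star-shaped with respect to the origin (no regularity of $\partial D$ is required). Let $\lambda>0$ and let $(\Phi,\mathcal R)=(\{z_j\},\{r_j\})$ be a marked Poisson point process of intensity $\lambda$: $\Phi=\{z_j\}$ is a homogeneous Poisson point process on $\mathbb R^3$ with intensity $\lambda$, and the marks $r_j\ge 0$ are independent and identically distributed random variables, independent of the points, with $\mathbb E(r_j^3)<\infty$. For $\varepsilon>0$ put $$\Phi^\varepsilon(D)=\{z\in\Phi:\ \varepsilon z\in D,\ \operatorname{dist}(\varepsilon z,\partial D)>\varepsilon\}.$$ Let $\alpha>3$, $\delta=(\alpha-3)/3$, $\kappa\in(\max(1,\delta),\alpha-2)$, $\tau\ge 1$ and $N=8(2+\lceil 1/\delta\rceil)$. Write $B_\rho(x)$ for the closed Euclidean ball and $\operatorname{dist}_\infty$ for the distance in the maximum norm. Then there is an almost surely positive random variable $\varepsilon_0$ such that for every $0<\varepsilon\le\varepsilon_0$ the following hold. 1. $\tau\varepsilon^\alpha r_i\le\varepsilon^{1+\kappa}$ for all $z_i\in\Phi^\varepsilon(D)$, and $B_{\tau\varepsilon^{1+\kappa}}(\varepsilon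 z_i)\cap B_{\tau\varepsilon^{1+\kappa}}(\varepsilon z_j)=\emptyset$ for all $z_i\ne z_j$ in $\Phi^\varepsilon(D)$. 2. There are finitely many open axis-parallel boxes $I_i^\varepsilon\subset D$ such that (a) $B_{\varepsilon^{1+\kappa}}(\varepsilon z)\subset\bigcup_i I_i^\varepsilon$ for every $z\in\Phi^\varepsilon(D)$; (b) every $I_i^\varepsilon$ contains at most $N$ points of $\varepsilon\Phi^\varepsilon(D)$; (c) if $z\in\Phi^\varepsilon(D)$ and $\varepsilon z\in I_i^\varepsilon$, then $\operatorname{dist}(B_{\varepsilon^{1+\kappa}}(\varepsilon z),\partial I_i^\varepsilon)\ge\frac{1}{16N}\varepsilon^{1+\delta}$; (d) $\operatorname{dist}_\infty(I_i^\varepsilon,I_j^\varepsilon)\ge\frac{1}{4N}\varepsilon^{1+\delta}$ for $i\ne j$; (e) every side of $I_i^\varepsilon$ has length at least $\frac{1}{2N}\varepsilon^{1+\delta}$ and at most $\varepsilon^{1+\delta}$. -/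

import Mathlib

open MeasureTheory ProbabilityTheory

/-- Three-dimensional Euclidean space. -/
abbrev E3 : Type := EuclideanSpace ℝ (Fin 3)

/-- The random point set `Φ(ω) = {z_j(ω)}` enumerated by the sequence `z`. -/
def pointSet {Ω : Type*} (z : ℕ → Ω → E3) (ω : Ω) : Set E3 :=
  Set.range fun j => z j ω

/-- `N(S) = #(S ∩ Φ)`, the (possibly infinite) number of points in `S`. -/
noncomputable def pointCount {Ω : Type*} (z : ℕ → Ω → E3) (S : Set E3) (ω : Ω) : ℕ∞ :=
  (S ∩ pointSet z ω).encard

/-- The points `z_j`, enumerated without repetition, form a homogeneous Poisson point process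
on `ℝ³` of intensity `lam > 0`. (Such a process has almost surely infinitely many points, so that
it can be enumerated by `ℕ`.) -/
structure IsPoissonPointProcess {Ω : Type*} [MeasurableSpace Ω] (μ : Measure Ω)
    (lam : ℝ) (z : ℕ → Ω → E3) : Prop where
  measurable_point : ∀ j, Measurable (z j)
  ae_injective : ∀ᵐ ω ∂μ, Function.Injective fun j => z j ω
  indep_count : ∀ (n : ℕ) (S : Fin n → Set E3), (∀ i, MeasurableSet (S i)) →
    Pairwise (fun i j => Disjoint (S i) (S j)) → iIndepFun (fun i => pointCount z (S i)) μ
  count_law : ∀ S : Set E3, MeasurableSet S → volume S ≠ ⊤ → ∀ k : ℕ,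
    μ.real {ω | pointCount z S ω = k} =
      (lam * volume.real S) ^ k * Real.exp (-(lam * volume.real S)) / (k.factorial : ℝ)

/-- `(Φ, R) = ({z_j}, {r_j})` is a marked Poisson point process of intensity `lam`: the marks
`r_j ≥ 0` are independent, identically distributed, and independent of the points. -/
structure IsMarkedPoissonPointProcess {Ω : Type*} [MeasurableSpace Ω] (μ : Measure Ω)
    (lam : ℝ) (z : ℕ → Ω → E3) (r : ℕ → Ω → ℝ) : Prop where
  points : IsPoissonPointProcess μ lam z
  measurable_mark : ∀ j, Measurable (r j)
  mark_nonneg : ∀ j, ∀ᵐ ω ∂μ, 0 ≤ r j ω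
  mark_iIndep : iIndepFun r μ
  mark_identDistrib : ∀ j, IdentDistrib (r j) (r 0) μ μ
  indep_points_marks : IndepFun (fun ω j => z j ω) (fun ω j => r j ω) μ

/-- `Φ^ε(D) = {z ∈ Φ ∩ ε⁻¹ D : dist(ε z, ∂D) > ε}`, for the point set `Φ`. -/
def innerPoints (Φ : Set E3) (D : Set E3) (ε : ℝ) : Set E3 :=
  {p | p ∈ Φ ∧ ε • p ∈ D ∧ ε < Metric.infDist (ε • p) (frontier D)}

/-- The open axis-parallel box `∏ᵢ (aᵢ, bᵢ)`. -/
def openBox (a b : Fin 3 → ℝ) : Set E3 :=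
  {x | ∀ i, a i < x i ∧ x i < b i}

/-- The distance of two points of `ℝ³` in the maximum norm. -/
noncomputable def distSup (x y : E3) : ℝ :=
  dist (WithLp.ofLp x) (WithLp.ofLp y)

/-- `N(δ) = 8 (2 + ⌈1/δ⌉)`. -/
noncomputable def clusterBound (δ : ℝ) : ℕ :=
  8 * (2 + ⌈1 / δ⌉₊)

/-!
By Borel–Cantelli along the scales `2⁻ᵏ`, a property of the process at scale `ε` holds below an
almost surely positive random scale as soon as it fails for some `ε ∈ (η / 2, η]` with probability
`O(η ^ β)`, where `β > 0`.

In a ball of radius `R / ε` all marks are at most `c ε ^ (-s)`, except with probability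
`O(ε ^ (3 (s - 1)))`, because `𝔼 r³ < ∞`. The ball is covered by `O(ε ^ (-3 (1 + γ)))` cubes of side
of order `ε ^ γ`, and a given one contains more than `n` points with probability
`O(ε ^ (3 γ (n + 1)))`; so, except with probability `O(ε ^ (3 (γ n - 1)))`, no more than `n` points
accumulate at distances of order `ε ^ γ`. With `n = 1` and `γ = κ` this separates the points, with
`n = N` and `γ = δ` it limits the clusters.

At a scale without accumulations put `h = ε ^ (1 + δ) / (4 N)` and glue the points of `ε Φ^ε(D)`
into clusters as long as two of them are not separated by an axis-parallel slab of width `3 h`.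
Clusters of `m` and `m'` points that are glued spread over at most `3 (m + m' - 1) h` in each
coordinate, so that no cluster ever exceeds `N` points. The bounding boxes of the final clusters,
enlarged by `h`, still have distance `h` from each other.
-/

open Filter Topology
open scoped NNReal ENNReal

section Threshold

variable {Ω : Type*} [MeasurableSpace Ω] {μ : Measure Ω} {Q Q' : Ω → ℝ → Prop}

/-- The property `Q ω ε` holds for all scales `ε` below a random threshold that is measurable and
almost surely positive. The threshold works for every `ω`: it is allowed to be `0` on a null set,
where nothing is claimed. -/
def HasThreshold (μ : Measure Ω) (Q : Ω → ℝ → Prop) : Prop :=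
  ∃ ε₀ : Ω → ℝ, Measurable ε₀ ∧ (∀ᵐ ω ∂μ, 0 < ε₀ ω) ∧ ∀ ω, ∀ ε : ℝ, 0 < ε → ε ≤ ε₀ ω → Q ω ε

namespace HasThreshold

theorem mono (h : HasThreshold μ Q) (hQ : ∀ ω ε, 0 < ε → Q ω ε → Q' ω ε) : HasThreshold μ Q' := by
  obtain ⟨e, em, ep, eQ⟩ := h
  exact ⟨e, em, ep, fun ω ε h0 hε => hQ ω ε h0 (eQ ω ε h0 hε)⟩

theorem and (h : HasThreshold μ Q) (h' : HasThreshold μ Q') :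
    HasThreshold μ fun ω ε => Q ω ε ∧ Q' ω ε := by
  obtain ⟨e, em, ep, eQ⟩ := h
  obtain ⟨e', em', ep', eQ'⟩ := h'
  refine ⟨fun ω => min (e ω) (e' ω), em.min em', ?_, fun ω ε h0 hε => ?_⟩
  · filter_upwards [ep, ep'] with ω h1 h2 using lt_min h1 h2
  · exact ⟨eQ ω ε h0 (hε.trans (min_le_left _ _)), eQ' ω ε h0 (hε.trans (min_le_right _ _))⟩

theorem of_eventually {q : ℝ → Prop} (h : ∀ᶠ ε in 𝓝[>] 0, q ε) :
    HasThreshold μ fun _ ε => q ε := by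
  obtain ⟨e, he, hq⟩ := mem_nhdsGT_iff_exists_Ioc_subset.1 h
  exact ⟨fun _ => e, measurable_const, .of_forall fun _ => he, fun _ ε h0 hε => hq ⟨h0, hε⟩⟩

theorem of_measurableSet_cover {G : ℕ → Set Ω} {t : ℕ → ℝ} (hG : ∀ n, MeasurableSet (G n))
    (hcover : ∀ᵐ ω ∂μ, ω ∈ ⋃ n, G n) (ht : ∀ n, 0 < t n)
    (hQ : ∀ n, ∀ ω ∈ G n, ∀ ε, 0 < ε → ε ≤ t n → Q ω ε) : HasThreshold μ Q := by
  classical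
  have hU : MeasurableSet (⋃ n, G n) := .iUnion hG
  have hex : ∀ ω, ∃ n, ω ∈ G n ∪ (⋃ m, G m)ᶜ := fun ω => by
    by_cases h : ω ∈ ⋃ m, G m
    · exact (Set.mem_iUnion.1 h).imp fun n hn => Or.inl hn
    · exact ⟨0, Or.inr h⟩
  refine ⟨fun ω => (⋃ m, G m).indicator (fun _ => t (Nat.find (hex ω))) ω, ?_, ?_, ?_⟩
  · exact Measurable.find (f := fun n => (⋃ m, G m).indicator fun _ => t n)
      (p := fun n ω => ω ∈ G n ∪ (⋃ m, G m)ᶜ)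
      (fun n => measurable_const.indicator hU) (fun n => (hG n).union hU.compl) hex
  · filter_upwards [hcover] with ω hω
    simpa only [Set.indicator_of_mem hω] using ht _
  · intro ω ε h0 hε
    have hω : ω ∈ ⋃ m, G m := Set.mem_of_indicator_ne_zero (h0.trans_le hε).ne'
    simp only [Set.indicator_of_mem hω] at hε
    exact hQ _ ω ((Nat.find_spec (hex ω)).resolve_right fun h => h hω) ε h0 hε

theorem of_ae (h : ∀ᵐ ω ∂μ, ∀ ε, 0 < ε → Q ω ε) : HasThreshold μ Q := by
  refine of_measurableSet_cover (G := fun _ => (toMeasurable μ {ω | ¬ ∀ ε, 0 < ε → Q ω ε})ᶜ)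
    (t := fun _ => 1) (fun _ => (measurableSet_toMeasurable _ _).compl) ?_ (fun _ => one_pos) ?_
  · rw [Set.iUnion_const]
    exact measure_eq_zero_iff_ae_notMem.1 ((measure_toMeasurable _).trans (ae_iff.1 h))
  · exact fun _ ω hω ε h0 _ => not_not.1 (fun hn => hω (subset_toMeasurable _ _ hn)) ε h0

theorem of_tsum_dyadic_ne_top
    (h : ∑' k : ℕ, μ {ω | ∃ ε ∈ Set.Ioc ((1 / 2 : ℝ) ^ (k + 1)) ((1 / 2) ^ k), ¬ Q ω ε} ≠ ⊤) :
    HasThreshold μ Q := by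
  set B : ℕ → Set Ω := fun k =>
    toMeasurable μ {ω | ∃ ε ∈ Set.Ioc ((1 / 2 : ℝ) ^ (k + 1)) ((1 / 2) ^ k), ¬ Q ω ε}
  refine of_measurableSet_cover (G := fun n => ⋂ k ≥ n, (B k)ᶜ) (t := fun n => (1 / 2) ^ n)
    (fun n => .biInter (Set.to_countable _) fun k _ => (measurableSet_toMeasurable _ _).compl)
    ?_ (fun n => by positivity) ?_
  · have hB : ∀ᵐ ω ∂μ, ∀ᶠ k in atTop, ω ∉ B k :=
      ae_eventually_notMem (by simpa only [B, measure_toMeasurable] using h)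
    filter_upwards [hB] with ω hω
    simpa only [Set.mem_iUnion, Set.mem_iInter, Set.mem_compl_iff] using eventually_atTop.1 hω
  · intro n ω hω ε h0 hε
    obtain ⟨k, hk, hk'⟩ := exists_nat_pow_near_of_lt_one h0
      (hε.trans (pow_le_one₀ (by norm_num) (by norm_num))) (one_half_pos (α := ℝ)) one_half_lt_one
    have hnk : n < k + 1 :=
      (pow_lt_pow_iff_right_of_lt_one₀ one_half_pos one_half_lt_one).1 (hk.trans_le hε)
    by_contra hQ
    exact Set.mem_iInter₂.1 hω k (Nat.lt_succ_iff.1 hnk)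
      (subset_toMeasurable _ _ ⟨ε, ⟨hk, hk'⟩, hQ⟩)

theorem of_measure_le_rpow {C β : ℝ} (hβ : 0 < β)
    (h : ∀ η : ℝ, 0 < η → η ≤ 1 →
      μ {ω | ∃ ε ∈ Set.Ioc (η / 2) η, ¬ Q ω ε} ≤ ENNReal.ofReal (C * η ^ β)) :
    HasThreshold μ Q := by
  have hsum : Summable fun k : ℕ => C * ((1 / 2 : ℝ) ^ k) ^ β := by
    simp_rw [← Real.rpow_pow_comm (one_half_pos (α := ℝ)).le]
    exact (summable_geometric_of_lt_one (by positivity)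
      (Real.rpow_lt_one (by norm_num) one_half_lt_one hβ)).mul_left C
  refine of_tsum_dyadic_ne_top (ne_top_of_le_ne_top hsum.tsum_ofReal_ne_top
    (ENNReal.tsum_le_tsum fun k => ?_))
  rw [pow_succ, mul_one_div]
  exact h _ (by positivity) (pow_le_one₀ (by norm_num) (by norm_num))

end HasThreshold

end Threshold

section Poisson

theorem tsum_poissonMeasure_singleton (r : ℝ≥0) : ∑' k, poissonMeasure r {k} = 1 := by
  simpa using (lintegral_countable' (μ := poissonMeasure r) 1).symm

theorem poissonMeasure_Ici_le (r : ℝ≥0) (m : ℕ) : poissonMeasure r (Set.Ici m) ≤ r ^ m := by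
  have hterm : ∀ k : ℕ, poissonMeasure r {k + m} ≤ r ^ m * poissonMeasure r {k} := fun k => by
    rw [poissonMeasure_singleton, poissonMeasure_singleton, ← ENNReal.ofReal_coe_nnreal,
      ← ENNReal.ofReal_pow r.coe_nonneg, ← ENNReal.ofReal_mul (by positivity)]
    refine ENNReal.ofReal_le_ofReal ?_
    rw [pow_add, ← mul_assoc, mul_comm _ ((r : ℝ) ^ m), mul_div_assoc]
    gcongr
    exact Nat.le_add_right k m
  have hIci : Set.Ici m = ⋃ k : ℕ, {k + m} := by
    ext n
    simp only [Set.mem_Ici, Set.mem_iUnion, Set.mem_singleton_iff]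
    exact ⟨fun h => ⟨n - m, (Nat.sub_add_cancel h).symm⟩, fun ⟨k, hk⟩ => hk ▸ Nat.le_add_left m k⟩
  calc poissonMeasure r (Set.Ici m)
      ≤ ∑' k : ℕ, poissonMeasure r {k + m} := hIci ▸ measure_iUnion_le _
    _ ≤ ∑' k : ℕ, r ^ m * poissonMeasure r {k} := ENNReal.tsum_le_tsum hterm
    _ = r ^ m := by rw [ENNReal.tsum_mul_left, tsum_poissonMeasure_singleton, mul_one]

theorem lintegral_natCast_poissonMeasure (r : ℝ≥0) :
    ∫⁻ n : ℕ, (n : ℝ≥0∞) ∂poissonMeasure r = r := by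
  have hterm : ∀ k : ℕ,
      ((k + 1 : ℕ) : ℝ≥0∞) * poissonMeasure r {k + 1} = r * poissonMeasure r {k} := fun k => by
    rw [poissonMeasure_singleton, poissonMeasure_singleton, ← ENNReal.ofReal_natCast,
      ← ENNReal.ofReal_coe_nnreal, ← ENNReal.ofReal_mul (by positivity),
      ← ENNReal.ofReal_mul (by positivity), Nat.factorial_succ]
    congr 1
    push_cast
    field_simp
    exact pow_succ' _ _
  rw [lintegral_countable', tsum_eq_zero_add' ENNReal.summable, Nat.cast_zero, zero_mul, zero_add]
  simp_rw [hterm]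
  rw [ENNReal.tsum_mul_left, tsum_poissonMeasure_singleton, mul_one]

namespace IsPoissonPointProcess

variable {Ω : Type*} [MeasurableSpace Ω] {μ : Measure Ω} {lam : ℝ} {z : ℕ → Ω → E3} {S : Set E3}

theorem intensity_nonneg (h : IsPoissonPointProcess μ lam z) : 0 ≤ lam := by
  have hlaw := h.count_law (Metric.closedBall 0 1) measurableSet_closedBall
    measure_closedBall_lt_top.ne 1
  have hvol : 0 < volume.real (Metric.closedBall (0 : E3) 1) :=
    ENNReal.toReal_pos (Metric.measure_closedBall_pos _ _ one_pos).ne'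
      measure_closedBall_lt_top.ne
  rw [pow_one, Nat.factorial_one, Nat.cast_one (R := ℝ), div_one] at hlaw
  have hprod := nonneg_of_mul_nonneg_left (hlaw ▸ measureReal_nonneg) (Real.exp_pos _)
  exact nonneg_of_mul_nonneg_left hprod hvol

theorem ae_pointCount_eq_encard (h : IsPoissonPointProcess μ lam z) (S : Set E3) :
    ∀ᵐ ω ∂μ, pointCount z S ω = {j | z j ω ∈ S}.encard := by
  filter_upwards [h.ae_injective] with ω hω
  rw [pointCount, pointSet, Set.inter_comm, ← Set.image_preimage_eq_range_inter, hω.encard_image]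
  rfl

theorem aemeasurable_pointCount (h : IsPoissonPointProcess μ lam z) (hS : MeasurableSet S) :
    AEMeasurable (pointCount z S) μ := by
  have hmeas : Measurable fun ω => {j | z j ω ∈ S} :=
    measurable_set_iff.2 fun j => measurableSet_setOfPred.1 (h.measurable_point j hS)
  exact ⟨_, measurable_encard.comp hmeas, h.ae_pointCount_eq_encard S⟩

theorem lintegral_pointCount (h : IsPoissonPointProcess μ lam z) (hS : MeasurableSet S) :
    ∫⁻ ω, pointCount z S ω ∂μ = ∑' j, μ (z j ⁻¹' S) := by
  calc ∫⁻ ω, pointCount z S ω ∂μ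
      = ∫⁻ ω, ∑' j, (z j ⁻¹' S).indicator 1 ω ∂μ := by
        refine lintegral_congr_ae ?_
        filter_upwards [h.ae_pointCount_eq_encard S] with ω hω
        rw [hω, ← ENNReal.tsum_set_one]
        exact tsum_subtype {j | z j ω ∈ S} fun _ => (1 : ℝ≥0∞)
    _ = ∑' j, μ (z j ⁻¹' S) := by
        rw [lintegral_tsum fun j =>
          (measurable_one.indicator (h.measurable_point j hS)).aemeasurable]
        exact tsum_congr fun j => lintegral_indicator_one (h.measurable_point j hS)

variable [IsProbabilityMeasure μ]

theorem hasLaw_pointCount (h : IsPoissonPointProcess μ lam z) (hS : MeasurableSet S)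
    (hvol : volume S ≠ ⊤) :
    HasLaw (pointCount z S)
      ((poissonMeasure (lam * volume.real S).toNNReal).map ((↑) : ℕ → ℕ∞)) μ := by
  have hcount := h.aemeasurable_pointCount hS
  have hcast : MeasurableEmbedding ((↑) : ℕ → ℕ∞) :=
    ⟨Nat.cast_injective, .of_discrete, fun _ _ => .of_discrete⟩
  have hcomap : poissonMeasure (lam * volume.real S).toNNReal =
      (μ.map (pointCount z S)).comap ((↑) : ℕ → ℕ∞) := by
    refine Measure.ext_of_singleton fun k => ?_
    rw [hcast.comap_apply, Set.image_singleton, Measure.map_apply_of_aemeasurable hcount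
      (.singleton _), poissonMeasure_singleton,
      Real.coe_toNNReal _ (mul_nonneg h.intensity_nonneg measureReal_nonneg), mul_comm (Real.exp _),
      ← h.count_law S hS hvol k, ofReal_measureReal]
    rfl
  have : IsProbabilityMeasure (μ.map (pointCount z S)) := Measure.isProbabilityMeasure_map hcount
  refine ⟨hcount, (Measure.eq_of_le_of_isProbabilityMeasure ?_).symm⟩
  rw [hcomap, hcast.map_comap]
  exact Measure.restrict_le_self

theorem measure_le_pointCount (h : IsPoissonPointProcess μ lam z) (hS : MeasurableSet S)
    (hvol : volume S ≠ ⊤) (m : ℕ) :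
    μ {ω | (m : ℕ∞) ≤ pointCount z S ω} ≤ ENNReal.ofReal ((lam * volume.real S) ^ m) := by
  rw [(h.hasLaw_pointCount hS hvol).measure_eq (p := fun n => (m : ℕ∞) ≤ n) .of_discrete,
    Measure.map_apply .of_discrete .of_discrete,
    ENNReal.ofReal_pow (mul_nonneg h.intensity_nonneg measureReal_nonneg)]
  convert! poissonMeasure_Ici_le _ m using 2
  ext n
  simp

theorem ae_pointCount_ne_top (h : IsPoissonPointProcess μ lam z) (hS : MeasurableSet S)
    (hvol : volume S ≠ ⊤) : ∀ᵐ ω ∂μ, pointCount z S ω ≠ ⊤ := by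
  rw [(h.hasLaw_pointCount hS hvol).ae_iff (p := fun n => n ≠ ⊤) .of_discrete,
    ae_map_iff .of_discrete .of_discrete]
  exact .of_forall fun n => ENat.natCast_ne_top n

theorem tsum_measure_preimage (h : IsPoissonPointProcess μ lam z) (hS : MeasurableSet S)
    (hvol : volume S ≠ ⊤) : ∑' j, μ (z j ⁻¹' S) = ENNReal.ofReal (lam * volume.real S) := by
  rw [← h.lintegral_pointCount hS, (h.hasLaw_pointCount hS hvol).lintegral_comp
    (f := fun n => (n : ℝ≥0∞)) .of_discrete, lintegral_map .of_discrete .of_discrete]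
  exact lintegral_natCast_poissonMeasure _

theorem ae_finite_inter_closedBall (h : IsPoissonPointProcess μ lam z) :
    ∀ᵐ ω ∂μ, ∀ ρ : ℝ, (pointSet z ω ∩ Metric.closedBall 0 ρ).Finite := by
  have hfin : ∀ᵐ ω ∂μ, ∀ n : ℕ, pointCount z (Metric.closedBall 0 n) ω ≠ ⊤ :=
    ae_all_iff.2 fun n => h.ae_pointCount_ne_top measurableSet_closedBall
      measure_closedBall_lt_top.ne
  filter_upwards [hfin] with ω hω ρ
  obtain ⟨n, hn⟩ := exists_nat_ge ρ
  refine (Set.encard_ne_top_iff.1 (hω n)).subset fun x hx => ⟨?_, hx.1⟩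
  exact Metric.closedBall_subset_closedBall hn hx.2

end IsPoissonPointProcess

end Poisson

section Sparse

variable {X Y : Type*} [PseudoMetricSpace X] [PseudoMetricSpace Y] {T T' : Set X} {s s' : ℝ} {N : ℕ}

/-- Every subset of `T` of diameter at most `s` has at most `N` elements. The bound on the diameter
is stated for pairs of points because `Metric.diam` is `0` on unbounded sets. -/
def IsSparse (T : Set X) (s : ℝ) (N : ℕ) : Prop :=
  ∀ A ⊆ T, (∀ p ∈ A, ∀ q ∈ A, dist p q ≤ s) → A.encard ≤ N

namespace IsSparse

theorem mono (h : IsSparse T s N) (hT : T' ⊆ T) (hs : s' ≤ s) : IsSparse T' s' N :=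
  fun A hA hAs => h A (hA.trans hT) fun p hp q hq => (hAs p hp q hq).trans hs

theorem image {f : X → Y} {K : ℝ} (hK : 0 ≤ K) (h : IsSparse T (K * s) N)
    (hf : ∀ p ∈ T, ∀ q ∈ T, dist p q ≤ K * dist (f p) (f q)) : IsSparse (f '' T) s N := by
  intro A hA hAs
  have hA' : f '' (T ∩ f ⁻¹' A) = A := by rwa [Set.image_inter_preimage, Set.inter_eq_right]
  rw [← hA']
  refine (Set.encard_image_le _ _).trans (h _ Set.inter_subset_left fun p hp q hq => ?_)
  exact (hf p hp.1 q hq.1).trans (mul_le_mul_of_nonneg_left (hAs _ hp.2 _ hq.2) hK)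

theorem lt_dist (h : IsSparse T s 1) (hs : 0 ≤ s) {p q : X} (hp : p ∈ T) (hq : q ∈ T)
    (hpq : p ≠ q) : s < dist p q := by
  by_contra! hle
  have hle' : dist q p ≤ s := dist_comm p q ▸ hle
  have hcard := h {p, q} (Set.insert_subset hp (Set.singleton_subset_iff.2 hq)) <| by
    rintro _ (rfl | rfl) _ (rfl | rfl) <;> simpa
  rw [Set.encard_pair hpq] at hcard
  exact absurd hcard (by norm_num)

end IsSparse

theorem exists_finset_closedBall_cover {ι : Type*} [Fintype ι] (hs : 0 < s) {ρ : ℝ} (hsρ : s ≤ ρ) :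
    ∃ I : Finset (ι → ℝ), (I.card : ℝ) ≤ (5 * ρ / s) ^ Fintype.card ι ∧
      ∀ p, ‖p‖ ≤ ρ → ∃ c ∈ I, dist p c ≤ s / 2 := by
  classical
  set K : ℕ := ⌈ρ / s⌉₊
  refine ⟨(Fintype.piFinset fun _ => Finset.Icc (-(K : ℤ)) K).image fun v i => v i * s, ?_, ?_⟩
  · have hK : (K : ℝ) < ρ / s + 1 := Nat.ceil_lt_add_one (div_nonneg (hs.le.trans hsρ) hs.le)
    have hρs : 1 ≤ ρ / s := (one_le_div hs).2 hsρ
    have hIcc : (K + 1 - -K : ℤ).toNat = 2 * K + 1 := by lia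
    calc (_ : ℝ) ≤ ((2 * K + 1 : ℕ) ^ Fintype.card ι : ℕ) := by
          refine Nat.cast_le.2 (Finset.card_image_le.trans_eq ?_)
          simp only [Fintype.card_piFinset, Int.card_Icc, hIcc, Finset.prod_const, Finset.card_univ]
      _ ≤ (5 * ρ / s) ^ Fintype.card ι := by
          push_cast
          gcongr
          rw [mul_div_assoc]
          linarith
  · intro p hp
    refine ⟨fun i => round (p i / s) * s, Finset.mem_image_of_mem _ ?_, ?_⟩
    · refine Fintype.mem_piFinset.2 fun i => Finset.mem_Icc.2 (abs_le.1 (Int.lt_add_one_iff.1 ?_))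
      have hpi : |p i / s| ≤ K := by
        rw [abs_div, abs_of_pos hs]
        exact (div_le_div_of_nonneg_right ((norm_le_pi_norm p i).trans hp) hs.le).trans
          (Nat.le_ceil _)
      have hround := abs_sub_round (p i / s)
      have htri := abs_sub_abs_le_abs_sub (round (p i / s) : ℝ) (p i / s)
      rw [abs_sub_comm] at htri
      have : |(round (p i / s) : ℝ)| < K + 1 := by linarith
      exact_mod_cast this
    · refine (dist_pi_le_iff (by positivity)).2 fun i => ?_
      calc dist (p i) (round (p i / s) * s)
          = |p i / s - round (p i / s)| * s := by
            rw [Real.dist_eq, ← abs_of_pos hs, ← abs_mul, abs_of_pos hs, sub_mul,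
              div_mul_cancel₀ _ hs.ne']
        _ ≤ 1 / 2 * s := mul_le_mul_of_nonneg_right (abs_sub_round _) hs.le
        _ = s / 2 := by ring

end Sparse

section PointProcess

variable {Ω : Type*} [MeasurableSpace Ω] {μ : Measure Ω} [IsProbabilityMeasure μ] {lam : ℝ}
  {z : ℕ → Ω → E3}

theorem distSup_le_dist (x y : E3) : distSup x y ≤ dist x y := by
  simpa [distSup] using (PiLp.lipschitzWith_ofLp 2 fun _ : Fin 3 => ℝ).dist_le_mul x y

theorem IsPoissonPointProcess.measure_not_isSparse_le (h : IsPoissonPointProcess μ lam z)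
    {s ρ : ℝ} (hs : 0 < s) (hsρ : s ≤ ρ) (n : ℕ) :
    μ {ω | ¬ IsSparse (pointSet z ω ∩ Metric.closedBall 0 ρ) s n} ≤
      ENNReal.ofReal ((5 * ρ / s) ^ 3 * (lam * (3 * s) ^ 3) ^ (n + 1)) := by
  obtain ⟨I, hIcard, hI⟩ := exists_finset_closedBall_cover (ι := Fin 3) hs hsρ
  set cube : (Fin 3 → ℝ) → Set E3 := fun c => WithLp.ofLp ⁻¹' Metric.closedBall c (3 / 2 * s)
  have hofLp := PiLp.volume_preserving_ofLp (Fin 3)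
  have hcube : ∀ c, volume (cube c) = ENNReal.ofReal ((3 * s) ^ 3) := fun c => by
    rw [hofLp.measure_preimage measurableSet_closedBall.nullMeasurableSet,
      Real.volume_pi_closedBall _ (by positivity), Fintype.card_fin]
    ring_nf
  have hcount : ∀ c ∈ I, μ {ω | ((n + 1 : ℕ) : ℕ∞) ≤ pointCount z (cube c) ω} ≤
      ENNReal.ofReal ((lam * (3 * s) ^ 3) ^ (n + 1)) := fun c _ => by
    have := h.measure_le_pointCount (hofLp.measurable measurableSet_closedBall)
      ((hcube c).trans_ne ENNReal.ofReal_ne_top) (n + 1)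
    rwa [measureReal_def, hcube, ENNReal.toReal_ofReal (by positivity)] at this
  have hsub : {ω | ¬ IsSparse (pointSet z ω ∩ Metric.closedBall 0 ρ) s n} ⊆
      ⋃ c ∈ I, {ω | ((n + 1 : ℕ) : ℕ∞) ≤ pointCount z (cube c) ω} := by
    intro ω hω
    simp only [IsSparse, Set.mem_ofPred_eq, not_forall, not_le] at hω
    obtain ⟨A, hA, hAs, hAn⟩ := hω
    obtain ⟨p, hp⟩ := Set.encard_pos.1 (pos_of_gt hAn)
    have hpρ : ‖WithLp.ofLp p‖ ≤ ρ := by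
      simpa [distSup] using (distSup_le_dist p 0).trans (hA hp).2
    obtain ⟨c, hcI, hpc⟩ := hI _ hpρ
    refine Set.mem_biUnion hcI ((Order.add_one_le_of_lt hAn).trans
      (Set.encard_le_encard fun q hq => ⟨?_, (hA hq).1⟩))
    rw [Set.mem_preimage, Metric.mem_closedBall]
    calc dist (WithLp.ofLp q) c
        ≤ dist (WithLp.ofLp q) (WithLp.ofLp p) + dist (WithLp.ofLp p) c := dist_triangle _ _ _
      _ ≤ s + s / 2 := add_le_add ((distSup_le_dist q p).trans (hAs q hq p hp)) hpc
      _ = 3 / 2 * s := by ring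
  calc _ ≤ ∑ c ∈ I, μ {ω | ((n + 1 : ℕ) : ℕ∞) ≤ pointCount z (cube c) ω} :=
        (measure_mono hsub).trans (measure_biUnion_finset_le _ _)
    _ ≤ I.card • ENNReal.ofReal ((lam * (3 * s) ^ 3) ^ (n + 1)) :=
        Finset.sum_le_card_nsmul _ _ _ hcount
    _ ≤ _ := by
        have := h.intensity_nonneg
        rw [← ENNReal.ofReal_nsmul, nsmul_eq_mul]
        gcongr
        simpa using hIcard

theorem IsPoissonPointProcess.hasThreshold_isSparse (h : IsPoissonPointProcess μ lam z) (R : ℝ)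
    {c γ : ℝ} (hc : 0 < c) (hγ : 0 ≤ γ) {n : ℕ} (hn : 1 < γ * n) :
    HasThreshold μ fun ω ε =>
      IsSparse (pointSet z ω ∩ Metric.closedBall 0 (R / ε)) (c * ε ^ γ) n := by
  set T : ℝ := max R c
  have hcT : c ≤ T := le_max_right _ _
  have hT : 0 < T := hc.trans_le hcT
  refine HasThreshold.of_measure_le_rpow (β := (γ * n - 1) * 3) (by linarith)
    (C := (10 * T / c) ^ 3 * (lam * (3 * c) ^ 3) ^ (n + 1)) fun η hη hη1 => ?_
  have hsρ : c * η ^ γ ≤ 2 * T / η := by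
    rw [le_div_iff₀ hη]
    have : η ^ γ * η ≤ 1 := mul_le_one₀ (Real.rpow_le_one hη.le hη1 hγ) hη.le hη1
    nlinarith
  have hsub : {ω | ∃ ε ∈ Set.Ioc (η / 2) η,
        ¬ IsSparse (pointSet z ω ∩ Metric.closedBall 0 (R / ε)) (c * ε ^ γ) n} ⊆
      {ω | ¬ IsSparse (pointSet z ω ∩ Metric.closedBall 0 (2 * T / η)) (c * η ^ γ) n} := by
    rintro ω ⟨ε, ⟨hε, hεη⟩, hsparse⟩ hcontra
    have hε0 : 0 < ε := (half_pos hη).trans hε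
    have hRε : R / ε ≤ 2 * T / η := by
      rw [div_le_div_iff₀ hε0 hη]
      nlinarith [le_max_left R c]
    exact hsparse (hcontra.mono
      (Set.inter_subset_inter_right _ (Metric.closedBall_subset_closedBall hRε)) (by gcongr))
  refine (measure_mono hsub).trans ((h.measure_not_isSparse_le (by positivity) hsρ n).trans_eq ?_)
  congr 1
  rw [Real.rpow_mul hη.le, Real.rpow_sub hη, Real.rpow_mul_natCast hη.le, Real.rpow_one,
    Real.rpow_ofNat]
  field_simp
  ring

end PointProcess

section MarkedProcess

theorem measure_lt_le_ofReal_integral_pow {Ω : Type*} [MeasurableSpace Ω] {μ : Measure Ω}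
    [IsFiniteMeasure μ] {f : Ω → ℝ} {k : ℕ} (hf : Integrable (fun ω => f ω ^ k) μ) {t : ℝ}
    (ht : 0 < t) : μ {ω | t < f ω} ≤ ENNReal.ofReal ((∫ ω, |f ω ^ k| ∂μ) / t ^ k) := by
  have hmarkov := mul_meas_ge_le_integral_of_nonneg (.of_forall fun ω => abs_nonneg (f ω ^ k))
    hf.abs (t ^ k)
  rw [mul_comm, ← le_div_iff₀ (by positivity)] at hmarkov
  rw [← ofReal_measureReal]
  refine ENNReal.ofReal_le_ofReal ((measureReal_mono fun ω hω => ?_).trans hmarkov)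
  exact (pow_le_pow_left₀ ht.le (le_of_lt hω) k).trans (le_abs_self _)

namespace IsMarkedPoissonPointProcess

variable {Ω : Type*} [MeasurableSpace Ω] {μ : Measure Ω} [IsProbabilityMeasure μ] {lam : ℝ}
  {z : ℕ → Ω → E3} {r : ℕ → Ω → ℝ}

theorem measure_exists_mem_lt_le (h : IsMarkedPoissonPointProcess μ lam z r) {S : Set E3}
    (hS : MeasurableSet S) (hvol : volume S ≠ ⊤) (t : ℝ) :
    μ {ω | ∃ j, z j ω ∈ S ∧ t < r j ω} ≤
      ENNReal.ofReal (lam * volume.real S) * μ {ω | t < r 0 ω} := by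
  have hprod : ∀ j, μ (z j ⁻¹' S ∩ r j ⁻¹' Set.Ioi t) = μ (z j ⁻¹' S) * μ {ω | t < r 0 ω} := by
    intro j
    have hind : IndepFun (z j) (r j) μ :=
      h.indep_points_marks.comp (measurable_pi_apply j) (measurable_pi_apply j)
    rw [hind.measure_inter_preimage_eq_mul _ _ hS measurableSet_Ioi]
    exact congrArg _ ((h.mark_identDistrib j).measure_mem_eq measurableSet_Ioi)
  calc μ {ω | ∃ j, z j ω ∈ S ∧ t < r j ω}
      = μ (⋃ j, (z j ⁻¹' S ∩ r j ⁻¹' Set.Ioi t)) := by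
        congr 1
        ext ω
        simp
    _ ≤ ∑' j, μ (z j ⁻¹' S ∩ r j ⁻¹' Set.Ioi t) := measure_iUnion_le _
    _ = _ := by
        simp_rw [hprod]
        rw [ENNReal.tsum_mul_right, h.points.tsum_measure_preimage hS hvol]

theorem hasThreshold_mark_le (h : IsMarkedPoissonPointProcess μ lam z r)
    (hr3 : Integrable (fun ω => r 0 ω ^ 3) μ) {R c s : ℝ} (hR : 0 ≤ R) (hc : 0 < c) (hs : 1 < s) :
    HasThreshold μ fun ω ε => ∀ j, z j ω ∈ Metric.closedBall 0 (R / ε) → r j ω ≤ c * ε ^ (-s) := by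
  set v := volume.real (Metric.ball (0 : E3) 1)
  refine HasThreshold.of_measure_le_rpow (β := (s - 1) * 3) (by linarith)
    (C := lam * ((2 * R) ^ 3 * v) * ((∫ ω, |r 0 ω ^ 3| ∂μ) / c ^ 3)) fun η hη _ => ?_
  have hsub : {ω | ∃ ε ∈ Set.Ioc (η / 2) η,
        ¬ ∀ j, z j ω ∈ Metric.closedBall 0 (R / ε) → r j ω ≤ c * ε ^ (-s)} ⊆
      {ω | ∃ j, z j ω ∈ Metric.closedBall 0 (2 * R / η) ∧ c * η ^ (-s) < r j ω} := by
    rintro ω ⟨ε, ⟨hε, hεη⟩, hmark⟩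
    push Not at hmark
    obtain ⟨j, hj, hrj⟩ := hmark
    have hε0 : 0 < ε := (half_pos hη).trans hε
    have hRε : R / ε ≤ 2 * R / η := by
      rw [div_le_div_iff₀ hε0 hη]
      nlinarith
    refine ⟨j, Metric.closedBall_subset_closedBall hRε hj, lt_of_le_of_lt ?_ hrj⟩
    exact mul_le_mul_of_nonneg_left
      (Real.rpow_le_rpow_of_nonpos hε0 hεη (by linarith)) hc.le
  refine (measure_mono hsub).trans
    ((h.measure_exists_mem_lt_le measurableSet_closedBall measure_closedBall_lt_top.ne _).trans
      ((mul_le_mul_right (measure_lt_le_ofReal_integral_pow hr3 (by positivity)) _).trans_eq ?_))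
  have hvol : volume.real (Metric.closedBall (0 : E3) (2 * R / η)) = (2 * R / η) ^ 3 * v := by
    rw [Measure.addHaar_real_closedBall _ _ (by positivity), finrank_euclideanSpace_fin]
  have := h.points.intensity_nonneg
  rw [hvol, ← ENNReal.ofReal_mul (by positivity)]
  congr 1
  rw [Real.rpow_mul hη.le, Real.rpow_sub hη, Real.rpow_neg hη.le, Real.rpow_one, Real.rpow_ofNat]
  field_simp

end IsMarkedPoissonPointProcess

end MarkedProcess

theorem exists_finpartition_pairwise {α : Type*} [DecidableEq α] (P : Finset α)
    (good : Finset α → Prop) (sep : Finset α → Finset α → Prop) (hsingle : ∀ p ∈ P, good {p})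
    (hunion : ∀ c ⊆ P, ∀ d ⊆ P, c.Nonempty → d.Nonempty → Disjoint c d → good c → good d →
      ¬ sep c d → good (c ∪ d)) :
    ∃ Q : Finpartition P, (∀ c ∈ Q.parts, good c) ∧ (Q.parts : Set (Finset α)).Pairwise sep := by
  -- Among the partitions into good parts take one with the fewest parts.
  obtain ⟨Q, hQ, hmin⟩ := exists_minimalFor_of_wellFoundedLT
    (fun Q : Finpartition P => ∀ c ∈ Q.parts, good c) (fun Q => Q.parts.card)
    ⟨⊥, fun c hc => by
      obtain ⟨p, hp, rfl⟩ := Finpartition.mem_bot_iff.1 hc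
      exact hsingle p hp⟩
  refine ⟨Q, hQ, fun c hc d hd hcd => ?_⟩
  by_contra hsep
  have hdisj : Disjoint c d := Q.disjoint hc hd hcd
  have hne : c.Nonempty := Q.nonempty_of_mem_parts hc
  let R : Finpartition P := (Q.avoid (c ∪ d)).extend
    (hne.mono Finset.subset_union_left).ne_empty Finset.sdiff_disjoint
    (Finset.sdiff_union_of_subset (Finset.union_subset (Q.le hc) (Q.le hd)))
  have hparts : (Q.avoid (c ∪ d)).parts ⊆ (Q.parts.erase c).erase d := by
    intro e he
    obtain ⟨f, hf, hfcd, rfl⟩ := (Finpartition.mem_avoid _).1 he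
    have hfc : f ≠ c := by rintro rfl; exact hfcd Finset.subset_union_left
    have hfd : f ≠ d := by rintro rfl; exact hfcd Finset.subset_union_right
    have hdisj' : Disjoint f (c ∪ d) :=
      Finset.disjoint_union_right.2 ⟨Q.disjoint hf hc hfc, Q.disjoint hf hd hfd⟩
    rw [Finset.sdiff_eq_self_of_disjoint hdisj']
    exact Finset.mem_erase.2 ⟨hfd, Finset.mem_erase.2 ⟨hfc, hf⟩⟩
  have hR : ∀ e ∈ R.parts, good e := by
    refine Finset.forall_mem_insert _ _ _ |>.2 ⟨?_, fun e he => hQ e ?_⟩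
    · exact hunion c (Q.le hc) d (Q.le hd) hne (Q.nonempty_of_mem_parts hd) hdisj (hQ c hc)
        (hQ d hd) hsep
    · exact Finset.mem_of_mem_erase (Finset.mem_of_mem_erase (hparts he))
  have hcardR : R.parts.card = (Q.avoid (c ∪ d)).parts.card + 1 := Finpartition.card_extend ..
  have hcard := Finset.card_le_card hparts
  have hcardd := Finset.card_erase_add_one (Finset.mem_erase.2 ⟨hcd.symm, hd⟩)
  have hcardc := Finset.card_erase_add_one hc
  have hle : R.parts.card ≤ Q.parts.card := by lia
  have := hmin hR hle
  lia

section Cluster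

variable {ι : Type*} {h : ℝ} {N : ℕ} {c d : Finset (ι → ℝ)} {a b a' b' : ι → ℝ}

/-- A cluster of at most `N` points which could have been assembled from single points by gluing
sets along gaps smaller than `3 h`; this limits the spread of each coordinate by the number of
points. -/
structure IsCluster (h : ℝ) (N : ℕ) (c : Finset (ι → ℝ)) : Prop where
  card_le : c.card ≤ N
  sub_le : ∀ p ∈ c, ∀ q ∈ c, ∀ i, p i - q i ≤ 3 * (c.card - 1) * h

/-- In one of the coordinates, `c` lies at least `3 h` below `d`, or conversely. -/
def IsSlabSeparated (h : ℝ) (c d : Finset (ι → ℝ)) : Prop :=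
  ∃ i, (∀ p ∈ c, ∀ q ∈ d, p i + 3 * h ≤ q i) ∨ ∀ p ∈ c, ∀ q ∈ d, q i + 3 * h ≤ p i

theorem isCluster_singleton (hN : 1 ≤ N) (p : ι → ℝ) : IsCluster h N {p} where
  card_le := by simpa using hN
  sub_le := by simp

theorem IsCluster.union [Fintype ι] [DecidableEq (ι → ℝ)] (hc : IsCluster h N c)
    (hd : IsCluster h N d) (hh : 0 ≤ h) (hsparse : IsSparse (c ∪ d : Set (ι → ℝ)) (6 * N * h) N)
    (hcne : c.Nonempty) (hdne : d.Nonempty) (hcd : Disjoint c d) (hsep : ¬ IsSlabSeparated h c d) :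
    IsCluster h N (c ∪ d) := by
  have hcard : ((c ∪ d).card : ℝ) = c.card + d.card := by
    exact_mod_cast Finset.card_union_of_disjoint hcd
  have hc1 : (1 : ℝ) ≤ c.card := by exact_mod_cast hcne.card_pos
  have hd1 : (1 : ℝ) ≤ d.card := by exact_mod_cast hdne.card_pos
  have hcN : (c.card : ℝ) ≤ N := by exact_mod_cast hc.card_le
  have hdN : (d.card : ℝ) ≤ N := by exact_mod_cast hd.card_le
  have hspread : ∀ p ∈ c ∪ d, ∀ q ∈ c ∪ d, ∀ i, p i - q i ≤ 3 * ((c ∪ d).card - 1) * h := by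
    intro p hp q hq i
    rw [hcard]
    simp only [IsSlabSeparated, not_exists, not_or] at hsep
    push Not at hsep
    obtain ⟨⟨u, hu, v, hv, huv⟩, ⟨u', hu', v', hv', huv'⟩⟩ := hsep i
    have hch : 0 ≤ (c.card - 1 : ℝ) * h := mul_nonneg (by linarith) hh
    have hdh : 0 ≤ (d.card - 1 : ℝ) * h := mul_nonneg (by linarith) hh
    rcases Finset.mem_union.1 hp with hp | hp <;> rcases Finset.mem_union.1 hq with hq | hq
    · linarith [hc.sub_le p hp q hq i]
    · linarith [hc.sub_le p hp u' hu' i, hd.sub_le v' hv' q hq i]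
    · linarith [hd.sub_le p hp v hv i, hc.sub_le u hu q hq i]
    · linarith [hd.sub_le p hp q hq i]
  refine ⟨?_, hspread⟩
  have hle : 3 * ((c ∪ d).card - 1 : ℝ) * h ≤ 6 * N * h := by
    rw [hcard]
    exact mul_le_mul_of_nonneg_right (by linarith) hh
  have hencard := hsparse (c ∪ d) subset_rfl fun p hp q hq => by
    refine (dist_pi_le_iff (by positivity)).2 fun i => abs_sub_le_iff.2 ?_
    rw [← Finset.coe_union, Finset.mem_coe] at hp hq
    exact ⟨(hspread p hp q hq i).trans hle, (hspread q hq p hp i).trans hle⟩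
  rwa [← Finset.coe_union, Set.encard_coe_eq_coe_finsetCard, Nat.cast_le] at hencard

theorem exists_finpartition_isCluster [Fintype ι] [DecidableEq (ι → ℝ)] {P : Finset (ι → ℝ)}
    (hh : 0 ≤ h) (hN : 1 ≤ N) (hP : IsSparse (P : Set (ι → ℝ)) (6 * N * h) N) :
    ∃ Q : Finpartition P, (∀ c ∈ Q.parts, IsCluster h N c) ∧
      (Q.parts : Set (Finset (ι → ℝ))).Pairwise (IsSlabSeparated h) :=
  exists_finpartition_pairwise P _ _ (fun p _ => isCluster_singleton hN p)
    fun _ hcP _ hdP hcne hdne hcd hc hd => hc.union hd hh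
      (hP.mono (Set.union_subset (Finset.coe_subset.2 hcP) (Finset.coe_subset.2 hdP)) le_rfl)
      hcne hdne hcd

/-- The box `∏ᵢ [a i, b i]` is the smallest axis-parallel box containing `c`, enlarged by `h` on
every side. -/
structure IsEnlargedHull (h : ℝ) (c : Finset (ι → ℝ)) (a b : ι → ℝ) : Prop where
  isLeast : ∀ i, IsLeast ((fun p : ι → ℝ => p i) '' (c : Set (ι → ℝ))) (a i + h)
  isGreatest : ∀ i, IsGreatest ((fun p : ι → ℝ => p i) '' (c : Set (ι → ℝ))) (b i - h)

theorem exists_isEnlargedHull (h : ℝ) (hc : c.Nonempty) : ∃ a b, IsEnlargedHull h c a b := by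
  let S (i : ι) : Set ℝ := (fun p : ι → ℝ => p i) '' (c : Set (ι → ℝ))
  have hfin (i : ι) : (S i).Finite := c.finite_toSet.image _
  have hne (i : ι) : (S i).Nonempty := hc.to_set.image _
  refine ⟨fun i => sInf (S i) - h, fun i => sSup (S i) + h, fun i => ?_, fun i => ?_⟩
  · rw [sub_add_cancel]
    exact ⟨(hne i).csInf_mem (hfin i), fun x hx => csInf_le (hfin i).bddBelow hx⟩
  · rw [add_sub_cancel_right]
    exact ⟨(hne i).csSup_mem (hfin i), fun x hx => le_csSup (hfin i).bddAbove hx⟩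

namespace IsEnlargedHull

theorem add_le (H : IsEnlargedHull h c a b) {p : ι → ℝ} (hp : p ∈ c) (i : ι) : a i + h ≤ p i :=
  (H.isLeast i).2 (Set.mem_image_of_mem _ hp)

theorem le_sub (H : IsEnlargedHull h c a b) {p : ι → ℝ} (hp : p ∈ c) (i : ι) : p i ≤ b i - h :=
  (H.isGreatest i).2 (Set.mem_image_of_mem _ hp)

theorem two_mul_le_sub (H : IsEnlargedHull h c a b) (i : ι) : 2 * h ≤ b i - a i := by
  obtain ⟨p, hp, hpa⟩ := (H.isLeast i).1
  have := H.le_sub hp i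
  dsimp only at hpa
  linarith

theorem sub_le (H : IsEnlargedHull h c a b) (hc : IsCluster h N c) (hh : 0 ≤ h) (i : ι) :
    b i - a i ≤ 4 * N * h := by
  obtain ⟨p, hp, hpa⟩ := (H.isLeast i).1
  obtain ⟨q, hq, hqb⟩ := (H.isGreatest i).1
  have hqp := hc.sub_le q hq p hp i
  have hcard : (c.card : ℝ) * h ≤ N * h := by
    have := hc.card_le
    gcongr
  have hNh : 0 ≤ N * h := by positivity
  dsimp only at hpa hqb
  linarith

theorem exists_le_abs_sub (H : IsEnlargedHull h c a b) (H' : IsEnlargedHull h d a' b')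
    (hsep : IsSlabSeparated h c d) :
    ∃ i, ∀ s ∈ Set.Ioo (a i) (b i), ∀ t ∈ Set.Ioo (a' i) (b' i), h ≤ |s - t| := by
  obtain ⟨i, hcd | hdc⟩ := hsep <;> refine ⟨i, fun s hs t ht => le_abs.2 ?_⟩
  · obtain ⟨p, hp, hpb⟩ := (H.isGreatest i).1
    obtain ⟨q, hq, hqa⟩ := (H'.isLeast i).1
    dsimp only at hpb hqa
    right
    linarith [hcd p hp q hq, hs.2, ht.1]
  · obtain ⟨p, hp, hpa⟩ := (H.isLeast i).1
    obtain ⟨q, hq, hqb⟩ := (H'.isGreatest i).1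
    dsimp only at hpa hqb
    left
    linarith [hdc p hp q hq, hs.1, ht.2]

end IsEnlargedHull

end Cluster

section Boxes

variable {D P : Set E3} {h ρ ℓ : ℝ} {N : ℕ}

theorem dist_le_two_mul_distSup (x y : E3) : dist x y ≤ 2 * distSup x y := by
  rw [EuclideanSpace.dist_eq, Fin.sum_univ_three]
  have hi (i : Fin 3) : dist (x i) (y i) ^ 2 ≤ distSup x y ^ 2 :=
    pow_le_pow_left₀ dist_nonneg (dist_le_pi_dist (WithLp.ofLp x) (WithLp.ofLp y) i) 2
  refine Real.sqrt_le_iff.2 ⟨mul_nonneg zero_le_two dist_nonneg, ?_⟩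
  linarith [hi 0, hi 1, hi 2, sq_nonneg (distSup x y)]

theorem abs_sub_le_dist (x y : E3) (i : Fin 3) : |x i - y i| ≤ dist x y :=
  (dist_le_pi_dist (WithLp.ofLp x) (WithLp.ofLp y) i).trans (distSup_le_dist x y)

theorem isOpen_openBox (a b : Fin 3 → ℝ) : IsOpen (openBox a b) := by
  simp only [openBox, Set.ofPred_forall, Set.ofPred_and]
  exact isOpen_iInter_of_finite fun i =>
    (isOpen_lt continuous_const (by fun_prop)).inter (isOpen_lt (by fun_prop) continuous_const)

theorem ball_subset_openBox {a b : Fin 3 → ℝ} {p : E3} (hp : ∀ i, a i + h ≤ p i ∧ p i ≤ b i - h) :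
    Metric.ball p h ⊆ openBox a b := by
  intro x hx i
  have hxi := abs_lt.1 ((abs_sub_le_dist x p i).trans_lt hx)
  constructor <;> linarith [hp i]

theorem le_dist_of_mem_frontier {X : Type*} [PseudoMetricSpace X] {U : Set X} {p x y : X}
    (hU : IsOpen U) (hp : Metric.ball p h ⊆ U) (hx : dist x p ≤ ρ) (hy : y ∈ frontier U) :
    h - ρ ≤ dist x y := by
  have hyp : h ≤ dist y p := not_lt.1 fun hlt => (hU.frontier_eq ▸ hy).2 (hp hlt)
  linarith [dist_triangle_left y p x]

theorem closedBall_subset_of_lt_infDist_frontier {E : Type*} [NormedAddCommGroup E]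
    [NormedSpace ℝ E] [FiniteDimensional ℝ E] {D : Set E} {p : E} {ε : ℝ} (hp : p ∈ D)
    (hε : ε < Metric.infDist p (frontier D)) : Metric.closedBall p ε ⊆ D := by
  intro x hx
  by_contra hxD
  obtain ⟨y, hy, hpy⟩ := exists_mem_frontier_infDist_compl_eq_dist hp
    (fun hD : D = Set.univ => hxD (hD ▸ Set.mem_univ x))
  have hlt : ε < Metric.infDist p Dᶜ :=
    hpy ▸ hε.trans_le (Metric.infDist_le_dist_of_mem hy)
  exact hlt.not_ge ((Metric.infDist_le_dist_of_mem hxD).trans (Metric.mem_closedBall'.1 hx))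

/-- The boxes `∏ₖ (aᵢₖ, bᵢₖ)` lie in `D`, are separated from each other and have side lengths
comparable to `ℓ`; they cover the `ρ`-neighbourhoods of the points of `P`, well inside, and each of
them contains at most `N` of these points. -/
structure IsSeparatedBoxCover {ι : Type*} (D P : Set E3) (ρ ℓ : ℝ) (N : ℕ)
    (a b : ι → Fin 3 → ℝ) : Prop where
  subset : ∀ i, openBox (a i) (b i) ⊆ D
  cover : ∀ p ∈ P, Metric.closedBall p ρ ⊆ ⋃ i, openBox (a i) (b i)
  encard_le : ∀ i, (openBox (a i) (b i) ∩ P).encard ≤ N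
  margin : ∀ i, ∀ p ∈ openBox (a i) (b i) ∩ P, ∀ x ∈ Metric.closedBall p ρ,
    ∀ y ∈ frontier (openBox (a i) (b i)), 1 / (16 * N) * ℓ ≤ dist x y
  separated : ∀ i j, i ≠ j → ∀ x ∈ openBox (a i) (b i), ∀ y ∈ openBox (a j) (b j),
    1 / (4 * N) * ℓ ≤ distSup x y
  side : ∀ i k, 1 / (2 * N) * ℓ ≤ b i k - a i k ∧ b i k - a i k ≤ ℓ

theorem IsSeparatedBoxCover.comp_equiv {ι ι' : Type*} {a b : ι → Fin 3 → ℝ}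
    (H : IsSeparatedBoxCover D P ρ ℓ N a b) (e : ι' ≃ ι) :
    IsSeparatedBoxCover D P ρ ℓ N (a ∘ e) (b ∘ e) where
  subset i := H.subset (e i)
  cover p hp := (H.cover p hp).trans_eq
    (e.surjective.iUnion_comp fun i => openBox (a i) (b i)).symm
  encard_le i := H.encard_le (e i)
  margin i := H.margin (e i)
  separated i j hij := H.separated (e i) (e j) (e.injective.ne hij)
  side i := H.side (e i)

section Hulls

variable {ι : Type*} {c : ι → Finset (Fin 3 → ℝ)} {a b : ι → Fin 3 → ℝ}

theorem le_distSup_of_mem_openBox (hhull : ∀ i, IsEnlargedHull h (c i) (a i) (b i))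
    (hsep : Pairwise fun i j => IsSlabSeparated h (c i) (c j)) {i j : ι} (hij : i ≠ j) {x y : E3}
    (hx : x ∈ openBox (a i) (b i)) (hy : y ∈ openBox (a j) (b j)) : h ≤ distSup x y := by
  obtain ⟨k, hk⟩ := (hhull i).exists_le_abs_sub (hhull j) (hsep hij)
  exact (hk _ (hx k) _ (hy k)).trans (dist_le_pi_dist (WithLp.ofLp x) (WithLp.ofLp y) k)

theorem ofLp_mem_of_mem_openBox (hh : 0 < h) (hhull : ∀ i, IsEnlargedHull h (c i) (a i) (b i))
    (hsep : Pairwise fun i j => IsSlabSeparated h (c i) (c j)) {i j : ι} {p : E3}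
    (hp : p ∈ openBox (a i) (b i)) (hpj : WithLp.ofLp p ∈ c j) : WithLp.ofLp p ∈ c i := by
  by_contra hpi
  have hij : i ≠ j := by rintro rfl; exact hpi hpj
  have hpj' : p ∈ openBox (a j) (b j) := ball_subset_openBox
    (fun k => ⟨(hhull j).add_le hpj k, (hhull j).le_sub hpj k⟩) (Metric.mem_ball_self hh)
  have hle := le_distSup_of_mem_openBox hhull hsep hij hp hpj'
  rw [distSup, dist_self] at hle
  exact hh.not_ge hle

theorem openBox_subset_closedBall {i : ι} (hhull : IsEnlargedHull h (c i) (a i) (b i))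
    (hc : IsCluster h N (c i)) (hh : 0 < h) {p : E3} (hp : WithLp.ofLp p ∈ c i) :
    openBox (a i) (b i) ⊆ Metric.closedBall p (2 * (4 * N * h)) := by
  intro x hx
  refine (dist_le_two_mul_distSup x p).trans (mul_le_mul_of_nonneg_left ?_ zero_le_two)
  refine (dist_pi_le_iff (by positivity)).2 fun k => abs_sub_le_iff.2 ?_
  have := hhull.sub_le hc hh.le k
  constructor <;> linarith [hx k, hhull.add_le hp k, hhull.le_sub hp k]

theorem isSeparatedBoxCover_of_isEnlargedHull (hN : 1 ≤ N) (hh : 0 < h)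
    (hhull : ∀ i, IsEnlargedHull h (c i) (a i) (b i)) (hc : ∀ i, IsCluster h N (c i))
    (hsep : Pairwise fun i j => IsSlabSeparated h (c i) (c j))
    (hP : ∀ p, p ∈ P ↔ ∃ i, WithLp.ofLp p ∈ c i)
    (hD : ∀ p ∈ P, Metric.closedBall p (2 * (4 * N * h)) ⊆ D) (hρ : ρ ≤ 3 / 4 * h) :
    IsSeparatedBoxCover D P ρ (4 * N * h) N a b := by
  have : (0 : ℝ) < N := by exact_mod_cast hN
  have hball {i : ι} {p : E3} (hp : WithLp.ofLp p ∈ c i) :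
      Metric.ball p h ⊆ openBox (a i) (b i) :=
    ball_subset_openBox fun k => ⟨(hhull i).add_le hp k, (hhull i).le_sub hp k⟩
  have hmem {i : ι} {p : E3} (hp : p ∈ openBox (a i) (b i) ∩ P) : WithLp.ofLp p ∈ c i :=
    let ⟨_, hj⟩ := (hP p).1 hp.2
    ofLp_mem_of_mem_openBox hh hhull hsep hp.1 hj
  have hmargin : 1 / (16 * N) * (4 * N * h) = h - 3 / 4 * h := by field_simp; norm_num
  have hgap : 1 / (4 * N) * (4 * N * h) = h := by field_simp
  have hside : 1 / (2 * N) * (4 * N * h) = 2 * h := by field_simp; norm_num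
  refine ⟨fun i => ?_, fun p hp => ?_, fun i => ?_, fun i p hp x hx y hy => ?_,
    fun i j hij x hx y hy => ?_, fun i k => ⟨?_, (hhull i).sub_le (hc i) hh.le k⟩⟩
  · obtain ⟨p, hp, -⟩ := ((hhull i).isLeast 0).1
    exact (openBox_subset_closedBall (p := WithLp.toLp 2 p) (hhull i) (hc i) hh hp).trans
      (hD _ ((hP _).2 ⟨i, hp⟩))
  · obtain ⟨i, hi⟩ := (hP p).1 hp
    exact (Metric.closedBall_subset_ball (by linarith)).trans
      ((hball hi).trans (Set.subset_iUnion (fun i => openBox (a i) (b i)) i))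
  · calc (openBox (a i) (b i) ∩ P).encard
        ≤ (c i : Set (Fin 3 → ℝ)).encard :=
          Set.encard_le_encard_of_injOn (fun p hp => hmem hp) (WithLp.ofLp_injective 2).injOn
      _ ≤ N := by
          rw [Set.encard_coe_eq_coe_finsetCard]
          exact_mod_cast (hc i).card_le
  · rw [hmargin]
    exact le_dist_of_mem_frontier (isOpen_openBox _ _) (hball (hmem hp))
      ((Metric.mem_closedBall.1 hx).trans hρ) hy
  · rw [hgap]
    exact le_distSup_of_mem_openBox hhull hsep hij hx hy
  · rw [hside]
    exact (hhull i).two_mul_le_sub k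

end Hulls

theorem exists_isSeparatedBoxCover (hPfin : P.Finite) (hN : 1 ≤ N) (hℓ : 0 < ℓ)
    (hP : IsSparse P (3 * ℓ) N) (hD : ∀ p ∈ P, Metric.closedBall p (2 * ℓ) ⊆ D)
    (hρ : ρ ≤ 3 / (16 * N) * ℓ) :
    ∃ (n : ℕ) (a b : Fin n → Fin 3 → ℝ), IsSeparatedBoxCover D P ρ ℓ N a b := by
  classical
  have : (0 : ℝ) < N := by exact_mod_cast hN
  obtain ⟨h, hh, rfl⟩ : ∃ h : ℝ, 0 < h ∧ ℓ = 4 * N * h :=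
    ⟨ℓ / (4 * N), by positivity, by field_simp⟩
  have hsparse : IsSparse (WithLp.ofLp '' P) (6 * N * h) N :=
    (hP.mono subset_rfl (by linarith)).image zero_le_two fun p _ q _ => dist_le_two_mul_distSup p q
  rw [← (hPfin.image _).coe_toFinset] at hsparse
  obtain ⟨Q, hcluster, hsep⟩ := exists_finpartition_isCluster hh.le hN hsparse
  choose a b hhull using fun c : Q.parts =>
    exists_isEnlargedHull h (Q.nonempty_of_mem_parts c.2)
  have hmem (p : E3) : p ∈ P ↔ ∃ c : Q.parts, WithLp.ofLp p ∈ c.1 := by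
    rw [← (WithLp.ofLp_injective 2).mem_set_image, ← (hPfin.image _).mem_toFinset]
    exact ⟨fun hp => let ⟨c, hc, hpc⟩ := Q.exists_mem hp; ⟨⟨c, hc⟩, hpc⟩,
      fun ⟨c, hpc⟩ => Q.le c.2 hpc⟩
  have hcover := isSeparatedBoxCover_of_isEnlargedHull hN hh hhull (fun c => hcluster c.1 c.2)
    (fun c d hcd => hsep c.2 d.2 (Subtype.coe_injective.ne hcd)) hmem hD
    (hρ.trans_eq (by field_simp; norm_num))
  exact ⟨_, _, _, hcover.comp_equiv Q.parts.equivFin.symm⟩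

end Boxes

section Scales

variable {Ω : Type*} [MeasurableSpace Ω] {μ : Measure Ω} [IsProbabilityMeasure μ] {lam : ℝ}
  {z : ℕ → Ω → E3} {r : ℕ → Ω → ℝ} {D : Set E3} {α δ κ τ ε : ℝ} {N : ℕ}

theorem eventually_rpow_le {y c : ℝ} (hy : 0 < y) (hc : 0 < c) :
    ∀ᶠ ε : ℝ in 𝓝[>] 0, ε ^ y ≤ c := by
  have h := (Real.continuousAt_rpow_const 0 y (Or.inr hy.le)).tendsto
  rw [Real.zero_rpow hy.ne'] at h
  exact (h.mono_left nhdsWithin_le_nhds).eventually_le_const hc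

theorem innerPoints_subset {R : ℝ} (Φ : Set E3) (hD : D ⊆ Metric.closedBall 0 R) (hε : 0 < ε) :
    innerPoints Φ D ε ⊆ Φ ∩ Metric.closedBall 0 (R / ε) := by
  intro p hp
  have hpD := mem_closedBall_zero_iff.1 (hD hp.2.1)
  rw [norm_smul, Real.norm_of_nonneg hε.le] at hpD
  exact ⟨hp.1, mem_closedBall_zero_iff.2 ((le_div_iff₀' hε).2 hpD)⟩

theorem IsMarkedPoissonPointProcess.hasThreshold_mul_mark_le
    (h : IsMarkedPoissonPointProcess μ lam z r) (hr3 : Integrable (fun ω => r 0 ω ^ 3) μ)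
    (hD : Bornology.IsBounded D) (hκ : κ < α - 2) (hτ : 0 < τ) :
    HasThreshold μ fun ω ε => ∀ j, z j ω ∈ innerPoints (pointSet z ω) D ε →
      τ * ε ^ α * r j ω ≤ ε ^ (1 + κ) := by
  obtain ⟨R, hR, hDR⟩ := hD.subset_closedBall_lt 0 0
  refine (h.hasThreshold_mark_le hr3 hR.le (inv_pos.2 hτ) (s := α - 1 - κ) (by linarith)).mono ?_
  intro ω ε hε hmark j hj
  have hr := hmark j (innerPoints_subset _ hDR hε hj).2
  calc τ * ε ^ α * r j ω ≤ τ * ε ^ α * (τ⁻¹ * ε ^ (-(α - 1 - κ))) := by gcongr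
    _ = ε ^ α * ε ^ (-(α - 1 - κ)) := by field_simp
    _ = ε ^ (1 + κ) := by rw [← Real.rpow_add hε]; congr 1; ring

theorem IsPoissonPointProcess.hasThreshold_disjoint_closedBall
    (h : IsPoissonPointProcess μ lam z) (hD : Bornology.IsBounded D) (hκ : 1 < κ) (hτ : 0 < τ) :
    HasThreshold μ fun ω ε => ∀ p ∈ innerPoints (pointSet z ω) D ε,
      ∀ q ∈ innerPoints (pointSet z ω) D ε, p ≠ q →
        Disjoint (Metric.closedBall (ε • p) (τ * ε ^ (1 + κ)))
          (Metric.closedBall (ε • q) (τ * ε ^ (1 + κ))) := by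
  obtain ⟨R, hDR⟩ := hD.subset_closedBall 0
  refine (h.hasThreshold_isSparse R (c := 2 * τ) (γ := κ) (n := 1) (by positivity) (by linarith)
    (by simpa using hκ)).mono fun ω ε hε hsparse p hp q hq hpq => ?_
  have hdist := hsparse.lt_dist (by positivity) (innerPoints_subset _ hDR hε hp)
    (innerPoints_subset _ hDR hε hq) hpq
  refine Metric.closedBall_disjoint_closedBall ?_
  calc τ * ε ^ (1 + κ) + τ * ε ^ (1 + κ) = ε * (2 * τ * ε ^ κ) := by
        rw [Real.rpow_add hε, Real.rpow_one]; ring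
    _ < ε * dist p q := by gcongr
    _ = dist (ε • p) (ε • q) := by rw [dist_smul₀, Real.norm_of_nonneg hε.le]

theorem exists_isSeparatedBoxCover_smul {T : Set E3} (hε : 0 < ε) (hTfin : T.Finite) (hN : 1 ≤ N)
    (hT : IsSparse T (3 * ε ^ δ) N) (hTD : ∀ p ∈ T, Metric.closedBall (ε • p) ε ⊆ D)
    (hεκ : ε ^ (κ - δ) ≤ 3 / (16 * N)) (hεδ : ε ^ δ ≤ 1 / 2) :
    ∃ (n : ℕ) (a b : Fin n → Fin 3 → ℝ), IsSeparatedBoxCover D ((fun p => ε • p) '' T)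
      (ε ^ (1 + κ)) (ε ^ (1 + δ)) N a b := by
  have hℓ : ε ^ (1 + δ) = ε * ε ^ δ := by rw [Real.rpow_add hε, Real.rpow_one]
  refine exists_isSeparatedBoxCover (hTfin.image _) hN (by positivity) ?_ ?_ ?_
  · refine IsSparse.image (inv_nonneg.2 hε.le) (hT.mono subset_rfl ?_) fun p _ q _ => ?_
    · rw [hℓ, mul_left_comm, inv_mul_cancel_left₀ hε.ne']
    · rw [dist_smul₀, Real.norm_of_nonneg hε.le, inv_mul_cancel_left₀ hε.ne']
  · rintro _ ⟨p, hp, rfl⟩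
    refine (Metric.closedBall_subset_closedBall ?_).trans (hTD p hp)
    rw [hℓ]
    nlinarith
  · calc ε ^ (1 + κ) = ε ^ (κ - δ) * ε ^ (1 + δ) := by
          rw [← Real.rpow_add hε]; congr 1; ring
      _ ≤ 3 / (16 * N) * ε ^ (1 + δ) := by gcongr

theorem IsPoissonPointProcess.hasThreshold_isSeparatedBoxCover (h : IsPoissonPointProcess μ lam z)
    (hD : Bornology.IsBounded D) (hδ : 0 < δ) (hδκ : δ < κ) (hN : 1 < δ * N) :
    HasThreshold μ fun ω ε => ∃ (n : ℕ) (a b : Fin n → Fin 3 → ℝ),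
      IsSeparatedBoxCover D ((fun p => ε • p) '' innerPoints (pointSet z ω) D ε)
        (ε ^ (1 + κ)) (ε ^ (1 + δ)) N a b := by
  have hN0 : 0 < N := Nat.pos_of_ne_zero fun h0 => by norm_num [h0] at hN
  obtain ⟨R, hDR⟩ := hD.subset_closedBall 0
  have hfin : HasThreshold μ fun ω ε => (pointSet z ω ∩ Metric.closedBall 0 (R / ε)).Finite :=
    .of_ae (h.ae_finite_inter_closedBall.mono fun ω hω ε _ => hω (R / ε))
  have hsparse := h.hasThreshold_isSparse R (c := 3) three_pos hδ.le hN
  have hsmall : HasThreshold μ fun _ ε => ε ^ (κ - δ) ≤ 3 / (16 * N : ℝ) ∧ ε ^ δ ≤ 1 / 2 :=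
    .of_eventually ((eventually_rpow_le (sub_pos.2 hδκ) (by positivity)).and
      (eventually_rpow_le hδ one_half_pos))
  refine ((hfin.and hsparse).and hsmall).mono ?_
  rintro ω ε hε ⟨⟨hfin, hsparse⟩, hεκ, hεδ⟩
  have hsub := innerPoints_subset (pointSet z ω) hDR hε
  exact exists_isSeparatedBoxCover_smul hε (hfin.subset hsub) hN0 (hsparse.mono hsub le_rfl)
    (fun p hp => closedBall_subset_of_lt_infDist_frontier hp.2.1 hp.2.2) hεκ hεδ

end Scales

theorem one_lt_mul_clusterBound {δ : ℝ} (hδ : 0 < δ) : 1 < δ * clusterBound δ := by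
  have hceil : 1 ≤ ⌈1 / δ⌉₊ * δ := (div_le_iff₀ hδ).1 (Nat.le_ceil _)
  unfold clusterBound
  push_cast
  nlinarith

theorem theorem3p1_general {Ω : Type*} [MeasurableSpace Ω] (μ : Measure Ω)
    [IsProbabilityMeasure μ] (D : Set E3) (hD : Bornology.IsBounded D) (lam : ℝ)
    (z : ℕ → Ω → E3) (r : ℕ → Ω → ℝ) (hzr : IsMarkedPoissonPointProcess μ lam z r)
    (hr3 : Integrable (fun ω => r 0 ω ^ 3) μ) (α δ κ τ : ℝ) (N : ℕ) (hδ : 0 < δ)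
    (hκ : κ ∈ Set.Ioo (max 1 δ) (α - 2)) (hτ : 0 < τ) (hN : 1 < δ * N) :
    HasThreshold μ fun ω ε =>
      (∀ j, z j ω ∈ innerPoints (pointSet z ω) D ε → τ * ε ^ α * r j ω ≤ ε ^ (1 + κ)) ∧
      (∀ p ∈ innerPoints (pointSet z ω) D ε, ∀ q ∈ innerPoints (pointSet z ω) D ε, p ≠ q →
        Disjoint (Metric.closedBall (ε • p) (τ * ε ^ (1 + κ)))
          (Metric.closedBall (ε • q) (τ * ε ^ (1 + κ)))) ∧
      ∃ (n : ℕ) (a b : Fin n → Fin 3 → ℝ),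
        IsSeparatedBoxCover D ((fun p => ε • p) '' innerPoints (pointSet z ω) D ε)
          (ε ^ (1 + κ)) (ε ^ (1 + δ)) N a b := by
  obtain ⟨hκ1, hκδ⟩ := max_lt_iff.1 hκ.1
  exact (hzr.hasThreshold_mul_mark_le hr3 hD hκ.2 hτ).and
    ((hzr.points.hasThreshold_disjoint_closedBall hD hκ1 hτ).and
      (hzr.points.hasThreshold_isSeparatedBoxCover hD hδ hκδ hN))

theorem theorem3p1 {Ω : Type*} [MeasurableSpace Ω] (μ : Measure Ω) [IsProbabilityMeasure μ]
    (D : Set E3) (hD_open : IsOpen D) (hD_bounded : Bornology.IsBounded D)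
    (hD_star : StarConvex ℝ 0 D)
    (lam : ℝ) (hlam : 0 < lam) (z : ℕ → Ω → E3) (r : ℕ → Ω → ℝ)
    (hzr : IsMarkedPoissonPointProcess μ lam z r)
    (hr3 : Integrable (fun ω => r 0 ω ^ 3) μ)
    (α δ κ τ : ℝ) (hα : 3 < α) (hδ : δ = (α - 3) / 3)
    (hκ : κ ∈ Set.Ioo (max 1 δ) (α - 2)) (hτ : 1 ≤ τ) :
    ∃ ε₀ : Ω → ℝ, Measurable ε₀ ∧ (∀ᵐ ω ∂μ, 0 < ε₀ ω) ∧
      ∀ ω, ∀ ε : ℝ, 0 < ε → ε ≤ ε₀ ω →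
        -- the radii are small
        (∀ j, z j ω ∈ innerPoints (pointSet z ω) D ε → τ * ε ^ α * r j ω ≤ ε ^ (1 + κ)) ∧
        -- the enlarged balls are pairwise disjoint
        (∀ p ∈ innerPoints (pointSet z ω) D ε, ∀ q ∈ innerPoints (pointSet z ω) D ε, p ≠ q →
          Disjoint (Metric.closedBall (ε • p) (τ * ε ^ (1 + κ)))
            (Metric.closedBall (ε • q) (τ * ε ^ (1 + κ)))) ∧
        -- there are finitely many open boxes contained in `D` such that
        ∃ (n : ℕ) (a b : Fin n → Fin 3 → ℝ),
          (∀ i, openBox (a i) (b i) ⊆ D) ∧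
          -- the boxes cover the balls
          (∀ p ∈ innerPoints (pointSet z ω) D ε,
            Metric.closedBall (ε • p) (ε ^ (1 + κ)) ⊆ ⋃ i, openBox (a i) (b i)) ∧
          -- each box contains at most `N` of the rescaled points
          (∀ i, {x : E3 | x ∈ openBox (a i) (b i) ∧
              ∃ p ∈ innerPoints (pointSet z ω) D ε, x = ε • p}.encard ≤ clusterBound δ) ∧
          -- the balls are well inside the boxes
          (∀ i, ∀ p ∈ innerPoints (pointSet z ω) D ε, ε • p ∈ openBox (a i) (b i) →
            ∀ x ∈ Metric.closedBall (ε • p) (ε ^ (1 + κ)),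
            ∀ y ∈ frontier (openBox (a i) (b i)),
              1 / (16 * clusterBound δ) * ε ^ (1 + δ) ≤ dist x y) ∧
          -- distinct boxes are well separated in the maximum norm
          (∀ i j, i ≠ j → ∀ x ∈ openBox (a i) (b i), ∀ y ∈ openBox (a j) (b j),
            1 / (4 * clusterBound δ) * ε ^ (1 + δ) ≤ distSup x y) ∧
          -- the side lengths are comparable to `ε ^ (1 + δ)`
          (∀ i k, 1 / (2 * clusterBound δ) * ε ^ (1 + δ) ≤ b i k - a i k ∧
            b i k - a i k ≤ ε ^ (1 + δ)) := by
  have hδ0 : 0 < δ := by linarith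
  refine (theorem3p1_general μ D hD_bounded lam z r hzr hr3 α δ κ τ (clusterBound δ) hδ0 hκ
    (zero_lt_one.trans_le hτ) (one_lt_mul_clusterBound hδ0)).mono ?_
  rintro ω ε - ⟨hmark, hdisj, n, a, b, hbox⟩
  refine ⟨hmark, hdisj, n, a, b, hbox.subset, fun p hp => hbox.cover _ ⟨p, hp, rfl⟩, fun i => ?_,
    fun i p hp hpi => hbox.margin i _ ⟨hpi, p, hp, rfl⟩, hbox.separated, hbox.side⟩
  refine (Set.encard_le_encard fun x hx => ?_).trans (hbox.encard_le i)
  exact ⟨hx.1, hx.2.imp fun p hp => ⟨hp.1, hp.2.symm⟩⟩
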